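/- Let $d\ge 1$ and $x\in(0,\infty)^d$. On a probability space with measure $P_0$, let $A^{(1)}<A^{(2)}<\dots$ be the arrival times of a Poisson process of rate one and let $Y^{(1)},Y^{(2)},\dots$ be i.i.d. random vectors in $\mathbb{R}^d$, independent of $(A^{(n)})_n$. Put $V_x^{(n)}=\max_{k}Y^{(n)}_k x_k$ and consider the point process $N=\sum_{n\ge1}\mathbb{1}_{(A^{(n)},V_x^{(n)})}$ on $\mathbb{R}^2$; its law is also denoted by $P_0$. On $\mathbb{R}^2$ take the cost $c((s,u),(t,v))=|u-v|$ if $s=t$ and $c((s,u),(t,v))=\infty$ if $s\ne t$. For counting measures $N,N'$ on $\mathbb{R}^2$ (with finitely or countably many atoms) let $$\widetilde c(N,N')=\inf\sum_{i}c(p_i,q_{\sigma(i)}),$$ the infimum being over all bijections $\sigma$ between the atoms $(p_i)$ of $N$ and the atoms $(q_i)$ of $N'$, listed with multiplicity ($\widetilde c=\infty$ if there is none). For laws $P,Q$ of random counting measures let $W_c(P,Q)=\inf_\gamma \mathbb{E}_{(N,N')\sim\gamma}\,\widetilde c(N,N')$, the infimum being over all couplings $\gamma$ of $P$ and $Q$.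 Let $\delta\ge0$ and $$D=\inf_{\lambda\ge0}\Big\{\lambda\delta+\mathbb{E}_{P_0}\Big[1-\lambda\min_{n\ge1}\big(A^{(n)}-V_x^{(n)}\big)^+\Big]^+\Big\}.$$ Then the minimum over $n$ is attained almost surely, and the following hold. (i) With $\mathcal{C}=\{(a,v): a\ge0,\ a\le v\}$, $\ell(t)=\mathbb{1}_{t\ge1}$ and $f=\mathbb{1}_{\mathcal{C}}$, $$\sup_{W_c(P,P_0)\le\delta}\mathbb{E}_{N\sim P}\Big[\ell\Big(\int f\,dN\Big)\Big]=D .$$ (ii) The worst-case value of the distribution function is $$\inf_{W_c(P,P_0)\le\delta}P'\big(M_1\le x_1^{-1},\dots,M_d\le x_d^{-1}\big)=1-D .$$ Here the infimum may be taken over all laws $P'$ of sequences $(A'^{(n)},Y'^{(n)})_{n\ge1}$ in $\mathbb{R}\times\mathbb{R}^d$ for which the law $P$ of $\sum_n\mathbb{1}_{(A'^{(n)},\,\max_kY'^{(n)}_kx_k)}$ satisfies $W_c(P,P_0)\le\delta$, with $M_k=\sup_nY'^{(n)}_k/A'^{(n)}$. Equivalently, it may be taken over all laws $P$ of random counting measures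 on $\mathbb{R}^2$ with $W_c(P,P_0)\le\delta$, the event being that no atom $(a,v)$ has $v>a$ (that is, $V_x^{(n)}\le A^{(n)}$ for all $n$). -/

import Mathlib

open MeasureTheory ProbabilityTheory
open scoped ENNReal NNReal

namespace RobustCDF

noncomputable section

/-- The counting measure `∑ₙ 𝟙_{z n}` with atoms `z 0, z 1, …` (with multiplicity). -/
def pointMeasure {S : Type*} [MeasurableSpace S] (z : ℕ → S) : Measure S :=
  Measure.sum fun n => Measure.dirac (z n)

/-- The matching cost between two counting measures induced by a cost `c` between points: the
infimum of `∑ᵢ c (xᵢ, yᵢ)` over all ways of matching the atoms of `N` bijectively with those of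
`N'`, that is, over all enumerations `N = ∑_{i ∈ I} 𝟙_{xᵢ}` and `N' = ∑_{i ∈ I} 𝟙_{yᵢ}` by a common
(finite or infinite) index set `I ⊆ ℕ`. It is `∞` if there is no such matching, in particular if
the total masses differ. -/
def matchingCost {S : Type*} [MeasurableSpace S] (c : S → S → ℝ≥0∞) (N N' : Measure S) : ℝ≥0∞ :=
  ⨅ (I : Set ℕ) (x : ℕ → S) (y : ℕ → S)
    (_ : N = Measure.sum fun i : I => Measure.dirac (x i))
    (_ : N' = Measure.sum fun i : I => Measure.dirac (y i)),
    ∑' i : I, c (x i) (y i)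

/-- The Wasserstein distance between two laws of random counting measures: the infimum over all
couplings of the expected matching cost. -/
def wasserstein {S : Type*} [MeasurableSpace S] (c : S → S → ℝ≥0∞)
    (P Q : Measure (Measure S)) : ℝ≥0∞ :=
  ⨅ (γ : Measure (Measure S × Measure S)) (_ : γ.fst = P) (_ : γ.snd = Q),
    ∫⁻ z, matchingCost c z.1 z.2 ∂γ

/-- The cost on the time-space plane that forbids moving the time coordinate:
`c((s, u), (t, v)) = ∞ 𝟙_{s ≠ t} + |u - v| 𝟙_{s = t}`. -/
def fixedTimeCost (p q : ℝ × ℝ) : ℝ≥0∞ :=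
  if p.1 = q.1 then ENNReal.ofReal |p.2 - q.2| else ⊤

/-- The laws of random counting measures on the plane within distance `δ` of `P₀`. -/
def ball (P₀ : Measure (Measure (ℝ × ℝ))) (δ : ℝ) : Set (Measure (Measure (ℝ × ℝ))) :=
  {P | IsProbabilityMeasure P ∧ wasserstein fixedTimeCost P P₀ ≤ ENNReal.ofReal δ}

/-- The gaps between consecutive arrival times. -/
def interarrival {Ω : Type*} (A : ℕ → Ω → ℝ) : ℕ → Ω → ℝ
  | 0 => A 0
  | n + 1 => fun ω => A (n + 1) ω - A n ω

/-- `A 0, A 1, …` are the successive arrival times of a Poisson process of rate one: the gaps are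
independent, exponentially distributed with rate one. -/
structure IsUnitPoissonArrivals {Ω : Type*} [MeasurableSpace Ω] (A : ℕ → Ω → ℝ)
    (μ : Measure Ω) : Prop where
  measurable : ∀ n, Measurable (A n)
  indep : iIndepFun (interarrival A) μ
  law : ∀ n, μ.map (interarrival A n) = expMeasure 1

/-- The spectral coordinate `max_k y_k x_k` of a mark `y`. -/
def spectral {d : ℕ} (x y : Fin d → ℝ) : ℝ := ⨆ k, y k * x k

/-- The planar counting measure `∑ₙ 𝟙_{(aₙ, max_k yₙ,ₖ xₖ)}` of a sequence of times and marks
`zₙ = (aₙ, yₙ)`. -/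
def planarProcess {d : ℕ} (x : Fin d → ℝ) (z : ℕ → ℝ × (Fin d → ℝ)) : Measure (ℝ × ℝ) :=
  pointMeasure fun n => ((z n).1, spectral x (z n).2)

/-- The componentwise maximum `M_k = sup_n yₙ,ₖ / aₙ` of a sequence of times and marks. -/
def compMax {d : ℕ} (z : ℕ → ℝ × (Fin d → ℝ)) (k : Fin d) : EReal :=
  ⨆ n, (((z n).2 k / (z n).1 : ℝ) : EReal)

/-- The region `{(a, v) | a ≥ 0, a ≤ v}`. -/
def failureRegion : Set (ℝ × ℝ) := {p | 0 ≤ p.1 ∧ p.1 ≤ p.2}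

/-- The loss `ℓ(t) = 𝟙_{t ≥ 1}`. -/
def loss (t : ℝ≥0∞) : ℝ := if 1 ≤ t then 1 else 0

end

end RobustCDF

namespace RobustCDF

/-! ### Counting measures and their evaluation on events -/

open Filter Topology

/-! Write `m` for the smallest gap `min_n (a - v)⁺` of the reference process. Moving times is
forbidden, so creating an atom with `a ≤ v` costs at least the gap of the atom it is matched with,
hence at least `m`. Thus, under any coupling, the indicator of that event is at most `l * cost + (1
- l * m)⁺`. Integrating and optimizing over `l` bounds its probability by `D`
(`measure_exists_le_le`, `measureReal_exists_le_le`).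

Conversely, raising one nearly minimizing atom just above its time costs about `m`. It remains to
choose an event `B` of large probability with `E[m; B] ≤ δ`, a fractional knapsack problem whose
dual value is `D`. Arrival times are atomless and independent of the marks, so `m` has no atom in
`(0, ∞)` and `t ↦ E[m; m ≤ t]` is continuous. A sublevel set can therefore use up the budget
exactly, and `l = 1/t` certifies that it is optimal (`exists_sublevel`). The small surplus of the
move is paid from a slightly reduced budget (`exists_transport`, `exists_near_optimal`).

The upper bound concerns the weak inequality `a ≤ v`, the construction gives the strict one with
positive times, and every event in the theorem lies between these two. The minimum is attained
because, by the strong law and both Borel-Cantelli lemmas, either some mark reaches its time or the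
gaps tend to infinity. -/

theorem measurable_pointMeasure {S α : Type*} [MeasurableSpace S] [MeasurableSpace α]
    {f : ℕ → α → S} (hf : ∀ n, Measurable (f n)) :
    Measurable fun a => pointMeasure fun n => f n a := by
  refine Measure.measurable_of_measurable_coe _ fun s hs => ?_
  simp only [pointMeasure, Measure.sum_apply _ hs]
  exact Measurable.tsum fun n =>
    (Measure.measurable_coe hs).comp (Measure.measurable_dirac.comp (hf n))

theorem sum_dirac_apply_ne_zero_iff {S ι : Type*} [MeasurableSpace S] {f : ι → S} {s : Set S}
    (hs : MeasurableSet s) :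
    (Measure.sum fun i => Measure.dirac (f i)) s ≠ 0 ↔ ∃ i, f i ∈ s := by
  rw [Measure.sum_apply _ hs, Ne, ENNReal.tsum_eq_zero, not_forall]
  refine exists_congr fun i => ?_
  rw [Measure.dirac_apply' _ hs]
  by_cases h : f i ∈ s <;> simp [h]

theorem pointMeasure_apply_ne_zero_iff {S : Type*} [MeasurableSpace S] {z : ℕ → S} {s : Set S}
    (hs : MeasurableSet s) : pointMeasure z s ≠ 0 ↔ ∃ n, z n ∈ s :=
  sum_dirac_apply_ne_zero_iff hs

theorem one_le_pointMeasure_apply {S : Type*} [MeasurableSpace S] {z : ℕ → S} {s : Set S}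
    (hs : MeasurableSet s) {n : ℕ} (hn : z n ∈ s) : 1 ≤ pointMeasure z s := by
  rw [pointMeasure, Measure.sum_apply _ hs]
  calc (1 : ℝ≥0∞) = Measure.dirac (z n) s := by rw [Measure.dirac_apply' _ hs]; simp [hn]
    _ ≤ _ := ENNReal.le_tsum n

theorem measurableSet_gap_lt (r : ℝ) : MeasurableSet {p : ℝ × ℝ | p.1 - p.2 < r} :=
  measurableSet_lt (by fun_prop) (by fun_prop)

theorem measurableSet_fst_le_snd : MeasurableSet {p : ℝ × ℝ | p.1 ≤ p.2} :=
  measurableSet_le (by fun_prop) (by fun_prop)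

theorem measurableSet_fst_lt_snd : MeasurableSet {p : ℝ × ℝ | p.1 < p.2} :=
  measurableSet_lt (by fun_prop) (by fun_prop)

theorem measurableSet_fst_nonpos : MeasurableSet {p : ℝ × ℝ | p.1 ≤ 0} :=
  measurableSet_le (by fun_prop) (by fun_prop)

theorem measurableSet_failureRegion : MeasurableSet failureRegion :=
  (measurableSet_le (f := fun _ : ℝ × ℝ => (0 : ℝ)) (by fun_prop) (by fun_prop)).inter
    measurableSet_fst_le_snd

/-! ### The gap of a counting measure and weak duality -/

/-- The infimum of `(a - v)⁺` over the atoms `(a, v)` of a counting measure. -/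
noncomputable def gapInf (N : Measure (ℝ × ℝ)) : ℝ≥0∞ :=
  open Classical in
  ⨆ q : ℚ, if N {p | p.1 - p.2 < q} = 0 then ENNReal.ofReal q else 0

theorem measurableSet_apply_eq_zero {S : Type*} [MeasurableSpace S] {s : Set S}
    (hs : MeasurableSet s) : MeasurableSet {N : Measure S | N s = 0} :=
  (Measure.measurable_coe hs) (measurableSet_singleton 0)

/-- Rational thresholds replace an infimum over atoms by a countable supremum of functions of `N`,
so no measurable enumeration of the atoms is needed. -/
theorem measurable_gapInf : Measurable gapInf := by
  classical
  refine Measurable.iSup fun q => Measurable.ite ?_ measurable_const measurable_const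
  exact measurableSet_apply_eq_zero (measurableSet_gap_lt q)

theorem gapInf_le {N : Measure (ℝ × ℝ)} {r : ℝ}
    (h : ∀ q : ℝ, r < q → N {p | p.1 - p.2 < q} ≠ 0) : gapInf N ≤ ENNReal.ofReal r := by
  classical
  refine iSup_le fun q => ?_
  split_ifs with hq
  · refine ENNReal.ofReal_le_ofReal ?_
    by_contra! hr
    exact h q hr hq
  · exact zero_le

theorem ofReal_le_gapInf {N : Measure (ℝ × ℝ)} {r : ℝ} (h : N {p | p.1 - p.2 < r} = 0) :
    ENNReal.ofReal r ≤ gapInf N := by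
  classical
  refine le_of_forall_lt fun b hb => ?_
  obtain ⟨q, -, h1, h2⟩ := ENNReal.lt_iff_exists_rat_btwn.1 hb
  refine h1.trans_le (le_trans (le_of_eq ?_) (le_iSup _ q))
  rw [if_pos, ENNReal.ofReal]
  refine measure_mono_null (fun p (hp : p.1 - p.2 < q) => ?_) h
  have h3 : (q : ℝ) < r := by
    by_contra! h4
    exact absurd h2 (not_lt.2 (ENNReal.ofReal_le_ofReal h4))
  exact hp.trans h3

/-- The partner of an atom with `a ≤ v` has the same time or costs `∞`; in the first case its mark
has to travel at least its own gap. -/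
theorem gapInf_le_matchingCost {N N' : Measure (ℝ × ℝ)} (h : N {p | p.1 ≤ p.2} ≠ 0) :
    gapInf N' ≤ matchingCost fixedTimeCost N N' := by
  refine le_iInf fun I => le_iInf fun x => le_iInf fun y => le_iInf fun hx => le_iInf fun hy => ?_
  rw [hx, sum_dirac_apply_ne_zero_iff measurableSet_fst_le_snd] at h
  obtain ⟨i, hi⟩ := h
  refine le_trans ?_ (ENNReal.le_tsum i)
  rw [fixedTimeCost]
  split_ifs with ht
  · refine (gapInf_le (r := (y i).1 - (y i).2) fun q hq => ?_).trans (ENNReal.ofReal_le_ofReal ?_)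
    · rw [hy, sum_dirac_apply_ne_zero_iff (measurableSet_gap_lt q)]
      exact ⟨i, hq⟩
    · have : (x i).1 ≤ (x i).2 := hi
      refine le_trans ?_ (le_abs_self _)
      linarith
  · exact le_top

theorem matchingCost_eq_top {N N' : Measure (ℝ × ℝ)} (h : N {p | p.1 ≤ 0} ≠ 0)
    (h' : N' {p | p.1 ≤ 0} = 0) : matchingCost fixedTimeCost N N' = ⊤ := by
  refine eq_top_iff.2 <| le_iInf fun I => le_iInf fun x => le_iInf fun y => le_iInf fun hx =>
    le_iInf fun hy => ?_
  rw [hx, sum_dirac_apply_ne_zero_iff measurableSet_fst_nonpos] at h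
  obtain ⟨i, hi⟩ := h
  refine le_trans ?_ (ENNReal.le_tsum i)
  rw [fixedTimeCost, if_neg]
  intro ht
  have hi' : (x i).1 ≤ 0 := hi
  refine (sum_dirac_apply_ne_zero_iff measurableSet_fst_nonpos).2 ⟨i, ?_⟩ (hy ▸ h')
  exact ht.symm.trans_le hi'

theorem matchingCost_pointMeasure_le {S : Type*} [MeasurableSpace S] (c : S → S → ℝ≥0∞)
    (z w : ℕ → S) : matchingCost c (pointMeasure z) (pointMeasure w) ≤ ∑' n, c (z n) (w n) := by
  have key : ∀ z : ℕ → S, pointMeasure z =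
      Measure.sum fun i : (Set.univ : Set ℕ) => Measure.dirac (z i) := fun z => by
    refine Measure.ext fun s hs => ?_
    rw [pointMeasure, Measure.sum_apply _ hs, Measure.sum_apply _ hs]
    exact (tsum_univ fun n => Measure.dirac (z n) s).symm
  refine (iInf_le _ Set.univ).trans <| (iInf_le _ z).trans <| (iInf_le _ w).trans <|
    (iInf_le _ (key z)).trans <| (iInf_le _ (key w)).trans ?_
  exact (tsum_univ fun n => c (z n) (w n)).le

theorem exists_coupling {S : Type*} [MeasurableSpace S] {c : S → S → ℝ≥0∞}
    {P Q : Measure (Measure S)} {b : ℝ≥0∞} (h : wasserstein c P Q < b) :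
    ∃ γ : Measure (Measure S × Measure S), γ.fst = P ∧ γ.snd = Q ∧
      ∫⁻ z, matchingCost c z.1 z.2 ∂γ < b := by
  simp only [wasserstein, iInf_lt_iff] at h
  obtain ⟨γ, h1, h2, h3⟩ := h
  exact ⟨γ, h1, h2, h3⟩

/-- Weak duality for the probability that some atom `(a, v)` has `a ≤ v`. -/
theorem measure_exists_le_le {P Q : Measure (Measure (ℝ × ℝ))} {b : ℝ≥0∞}
    (h : wasserstein fixedTimeCost P Q < b) (l : ℝ≥0) :
    P {N | N {p | p.1 ≤ p.2} ≠ 0} ≤ l * b + ∫⁻ N, (1 - l * gapInf N) ∂Q := by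
  classical
  obtain ⟨γ, rfl, rfl, hb⟩ := exists_coupling h
  set S : Set (Measure (ℝ × ℝ)) := {N | N {p | p.1 ≤ p.2} ≠ 0}
  have hS : MeasurableSet S := (measurableSet_apply_eq_zero measurableSet_fst_le_snd).compl
  have hm : Measurable fun N => 1 - (l : ℝ≥0∞) * gapInf N :=
    measurable_const.sub (measurable_gapInf.const_mul _)
  have hg : Measurable fun z : Measure (ℝ × ℝ) × Measure (ℝ × ℝ) =>
      (Prod.fst ⁻¹' S).indicator (fun z => gapInf z.2) z :=
    (measurable_gapInf.comp measurable_snd).indicator (measurable_fst hS)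
  rw [Measure.fst_apply hS, Measure.snd, lintegral_map hm measurable_snd,
    ← lintegral_indicator_one (measurable_fst hS)]
  calc ∫⁻ z, (Prod.fst ⁻¹' S).indicator 1 z ∂γ
      ≤ ∫⁻ z, (l * (Prod.fst ⁻¹' S).indicator (fun z => gapInf z.2) z +
          (1 - l * gapInf z.2)) ∂γ := by
        -- Truncated subtraction in `ℝ≥0∞` is the positive part, so on `S` this is `1 ≤ l * g + (1 -
        -- l * g)⁺`.
        refine lintegral_mono fun z => ?_
        by_cases hz : z ∈ Prod.fst ⁻¹' S
        · simp only [Set.indicator_of_mem hz, Pi.one_apply]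
          exact le_add_tsub
        · simp [Set.indicator_of_notMem hz]
    _ = l * ∫⁻ z, (Prod.fst ⁻¹' S).indicator (fun z => gapInf z.2) z ∂γ +
          ∫⁻ z, (1 - l * gapInf z.2) ∂γ := by
        rw [lintegral_add_left (hg.const_mul _), lintegral_const_mul _ hg]
    _ ≤ _ := by
        gcongr
        -- Only monotonicity of the integral is used here, so the matching cost need not be
        -- measurable.
        refine le_trans (lintegral_mono fun z => ?_) hb.le
        by_cases hz : z ∈ Prod.fst ⁻¹' S
        · simp only [Set.indicator_of_mem hz]
          exact gapInf_le_matchingCost hz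
        · simp [Set.indicator_of_notMem hz]

/-- At finite distance the times of the atoms stay positive. -/
theorem ae_apply_fst_nonpos_eq_zero {P Q : Measure (Measure (ℝ × ℝ))}
    (h : wasserstein fixedTimeCost P Q < ⊤) (hQ : ∀ᵐ N ∂Q, N {p | p.1 ≤ 0} = 0) :
    ∀ᵐ N ∂P, N {p | p.1 ≤ 0} = 0 := by
  classical
  obtain ⟨γ, rfl, rfl, hb⟩ := exists_coupling h
  have hZ := measurableSet_apply_eq_zero measurableSet_fst_nonpos
  rw [Measure.snd, ae_map_iff measurable_snd.aemeasurable hZ] at hQ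
  rw [Measure.fst, ae_map_iff measurable_fst.aemeasurable hZ]
  set B : Set (Measure (ℝ × ℝ) × Measure (ℝ × ℝ)) :=
    {z | z.1 {p | p.1 ≤ 0} ≠ 0 ∧ z.2 {p | p.1 ≤ 0} = 0}
  have hB : MeasurableSet B := (measurable_fst hZ.compl).inter (measurable_snd hZ)
  have h0 : γ B = 0 := by
    by_contra h0
    refine (lt_of_le_of_lt ?_ hb).ne rfl
    calc (⊤ : ℝ≥0∞) = ∫⁻ z, B.indicator (fun _ => ⊤) z ∂γ := by
          rw [lintegral_indicator_const hB, ENNReal.top_mul h0]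
      _ ≤ _ := lintegral_mono fun z => by
          by_cases hz : z ∈ B
          · simp only [Set.indicator_of_mem hz]
            exact (matchingCost_eq_top hz.1 hz.2).ge
          · simp [Set.indicator_of_notMem hz]
  have h1 : ∀ᵐ z ∂γ, z ∉ B := measure_eq_zero_iff_ae_notMem.1 h0
  filter_upwards [hQ, h1] with z hz hzB
  by_contra hz1
  exact hzB ⟨hz1, hz⟩

/-! ### The exponential law -/

theorem expMeasure_absolutelyContinuous (r : ℝ) : expMeasure r ≪ volume :=
  withDensity_absolutelyContinuous _ _

theorem expMeasure_Iic_zero (r : ℝ) : expMeasure r (Set.Iic 0) = 0 := by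
  rw [← Set.Iio_union_right, measure_union_null_iff]
  refine ⟨?_, expMeasure_absolutelyContinuous r Real.volume_singleton⟩
  rw [expMeasure, gammaMeasure, withDensity_apply _ measurableSet_Iio]
  exact lintegral_exponentialPDF_of_nonpos le_rfl

theorem integrable_id_expMeasure : Integrable (fun x : ℝ => x) (expMeasure 1) := by
  have hm : Measurable (exponentialPDF 1) := (measurable_exponentialPDFReal 1).ennreal_ofReal
  have h : expMeasure 1 = volume.withDensity (exponentialPDF 1) := rfl
  rw [h, integrable_withDensity_iff hm (ae_of_all _ fun x => ENNReal.ofReal_lt_top)]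
  -- The integrand of `Γ(2)`, with the exponent left as `2 - 1` to match the Gamma integral.
  have h2 : (fun x : ℝ => x * (exponentialPDF 1 x).toReal) =
      (Set.Ioi (0 : ℝ)).indicator fun x => Real.exp (-x) * x ^ ((2 : ℝ) - 1) := by
    funext x
    rw [exponentialPDF_eq]
    rcases lt_trichotomy x 0 with hx | rfl | hx
    · simp [hx.not_ge, hx.le]
    · simp
    · norm_num [hx, hx.le, Real.exp_nonneg, mul_comm]
  rw [h2, integrable_indicator_iff measurableSet_Ioi]
  exact Real.GammaIntegral_convergent two_pos

/-! ### Arrival times, and attainment of the minimum -/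

section Arrivals

variable {Ω : Type*} [MeasurableSpace Ω] {μ : Measure Ω}

theorem sum_interarrival {Ω : Type*} (A : ℕ → Ω → ℝ) (n : ℕ) (ω : Ω) :
    ∑ i ∈ Finset.range (n + 1), interarrival A i ω = A n ω := by
  induction n with
  | zero => simp [interarrival]
  | succ n ih => rw [Finset.sum_range_succ, ih]; simp [interarrival]

theorem measurable_interarrival {A : ℕ → Ω → ℝ} (hA : ∀ n, Measurable (A n)) (n : ℕ) :
    Measurable (interarrival A n) := by
  cases n with
  | zero => exact hA 0
  | succ n => exact (hA (n + 1)).sub (hA n)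

theorem IsUnitPoissonArrivals.ae_pos {A : ℕ → Ω → ℝ} (hA : IsUnitPoissonArrivals A μ) :
    ∀ᵐ ω ∂μ, ∀ n, 0 < A n ω := by
  have h : ∀ᵐ ω ∂μ, ∀ n, 0 < interarrival A n ω := by
    refine ae_all_iff.2 fun n => ?_
    have h0 : (μ.map (interarrival A n)) (Set.Iic 0) = 0 := by
      rw [hA.law, expMeasure_Iic_zero]
    rw [Measure.map_apply (measurable_interarrival hA.measurable n) measurableSet_Iic] at h0
    filter_upwards [measure_eq_zero_iff_ae_notMem.1 h0] with ω hω
    simpa using hω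
  filter_upwards [h] with ω hω n
  rw [← sum_interarrival A n ω]
  exact Finset.sum_pos (fun i _ => hω i) ⟨0, by simp⟩

/-- Fubini: for each fixed value of `Z`, the independent atomless `X` hits the single point `Z + c`
with probability zero. -/
theorem measure_eq_add_const_eq_zero [IsProbabilityMeasure μ] {X Z : Ω → ℝ} (hX : Measurable X)
    (hZ : Measurable Z) (hXZ : IndepFun X Z μ) (hX0 : ∀ c, μ.map X {c} = 0) (c : ℝ) :
    μ {ω | X ω = Z ω + c} = 0 := by
  have hs : MeasurableSet {p : ℝ × ℝ | p.2 = p.1 + c} :=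
    measurableSet_eq_fun (by fun_prop) (by fun_prop)
  have h := (indepFun_iff_map_prod_eq_prod_map_map hZ.aemeasurable hX.aemeasurable).1 hXZ.symm
  have : IsProbabilityMeasure (μ.map X) := Measure.isProbabilityMeasure_map hX.aemeasurable
  calc μ {ω | X ω = Z ω + c} = μ.map (fun ω => (Z ω, X ω)) {p | p.2 = p.1 + c} := by
        rw [Measure.map_apply (hZ.prodMk hX) hs]; rfl
    _ = 0 := by
        rw [h, Measure.prod_apply hs, lintegral_eq_zero_iff (measurable_measure_prodMk_left hs)]
        exact ae_of_all _ fun z => hX0 (z + c)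

theorem IsUnitPoissonArrivals.map_singleton [IsProbabilityMeasure μ] {A : ℕ → Ω → ℝ}
    (hA : IsUnitPoissonArrivals A μ) (n : ℕ) (c : ℝ) : μ.map (A n) {c} = 0 := by
  have hm := measurable_interarrival hA.measurable
  have h0 : ∀ n c, μ.map (interarrival A n) {c} = 0 := fun n c => by
    rw [hA.law]; exact expMeasure_absolutelyContinuous 1 Real.volume_singleton
  -- The arrival time is its last gap plus an independent sum, so it inherits the atomlessness of
  -- the gap.
  have hi : IndepFun (interarrival A n) (-∑ i ∈ Finset.range n, interarrival A i) μ :=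
    (hA.indep.indepFun_finsetSum_of_notMem hm (Finset.notMem_range_self)).symm.comp
      measurable_id measurable_neg
  have hZ : Measurable (-∑ i ∈ Finset.range n, interarrival A i) :=
    Measurable.neg (by convert! Finset.measurable_sum (Finset.range n) fun i _ => hm i; simp)
  rw [Measure.map_apply (hA.measurable n) (measurableSet_singleton c)]
  refine measure_mono_null (fun ω (hω : A n ω = c) => ?_)
    (measure_eq_add_const_eq_zero (hm n) hZ hi (h0 n) c)
  rw [← sum_interarrival A, Finset.sum_range_succ] at hω
  change interarrival A n ω = -(∑ i ∈ Finset.range n, interarrival A i) ω + c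
  rw [Finset.sum_apply]
  linarith

/-- The arrival times grow linearly. -/
theorem IsUnitPoissonArrivals.exists_tendsto [IsProbabilityMeasure μ] {A : ℕ → Ω → ℝ}
    (hA : IsUnitPoissonArrivals A μ) :
    ∃ c : ℝ, 0 < c ∧ ∀ᵐ ω ∂μ, Tendsto (fun n : ℕ => A n ω / ((n + 1 : ℕ) : ℝ)) atTop (𝓝 c) := by
  have hm := measurable_interarrival hA.measurable
  have hid : ∀ n, IdentDistrib (interarrival A n) (interarrival A 0) μ μ := fun n =>
    ⟨(hm n).aemeasurable, (hm 0).aemeasurable, by rw [hA.law, hA.law]⟩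
  have hint : Integrable (interarrival A 0) μ := by
    have h := integrable_id_expMeasure
    rw [← hA.law 0] at h
    exact h.comp_measurable (hm 0)
  refine ⟨∫ ω, interarrival A 0 ω ∂μ, ?_, ?_⟩
  · have hpos : ∀ᵐ ω ∂μ, 0 < interarrival A 0 ω := by
      filter_upwards [hA.ae_pos] with ω hω using hω 0
    rw [integral_pos_iff_support_of_nonneg_ae (hpos.mono fun ω h => h.le) hint]
    have h1 : μ (Function.support (interarrival A 0))ᶜ = 0 := by
      refine measure_mono_null (fun ω hω => ?_) (ae_iff.1 hpos)
      have hω' : interarrival A 0 ω = 0 := Function.notMem_support.1 hω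
      exact hω'.not_gt
    rw [(prob_compl_eq_zero_iff (measurableSet_support (hm 0))).1 h1]
    exact one_pos
  · filter_upwards [strong_law_ae_real (interarrival A) hint
      (fun i j hij => hA.indep.indepFun hij) hid] with ω hω
    -- `A n` is the sum of `n + 1` gaps, whence the shift by one.
    refine (hω.comp (tendsto_add_atTop_nat 1)).congr fun n => ?_
    simp only [Function.comp_apply, sum_interarrival]

/-- Of a nonnegative real random variable, the tail probabilities at the natural numbers are
summable only if it is integrable. -/
theorem integrable_of_tsum_tail_ne_top {X : Ω → ℝ} (hX : Measurable X)
    (h0 : ∀ ω, 0 ≤ X ω) (h : ∑' n : ℕ, μ {ω | (n : ℝ) < X ω} ≠ ⊤) : Integrable X μ := by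
  refine ⟨hX.aestronglyMeasurable, ?_⟩
  rw [hasFiniteIntegral_iff_ofReal (ae_of_all _ h0)]
  have hs : ∀ n : ℕ, MeasurableSet {ω | (n : ℝ) < X ω} := fun n =>
    measurableSet_lt measurable_const hX
  refine lt_of_le_of_lt ?_ h.lt_top
  calc ∫⁻ ω, ENNReal.ofReal (X ω) ∂μ
      ≤ ∫⁻ ω, ∑' n : ℕ, {ω | (n : ℝ) < X ω}.indicator 1 ω ∂μ := by
        refine lintegral_mono fun ω => ?_
        calc ENNReal.ofReal (X ω) ≤ ENNReal.ofReal (⌈X ω⌉₊ : ℝ) :=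
              ENNReal.ofReal_le_ofReal (Nat.le_ceil _)
          _ = ∑ n ∈ Finset.range ⌈X ω⌉₊, {ω | (n : ℝ) < X ω}.indicator (1 : Ω → ℝ≥0∞) ω := by
              have h1 : ∀ n ∈ Finset.range ⌈X ω⌉₊,
                  {ω | (n : ℝ) < X ω}.indicator (1 : Ω → ℝ≥0∞) ω = 1 := fun n hn =>
                Set.indicator_of_mem (s := {ω | (n : ℝ) < X ω})
                  (Nat.lt_ceil.1 (Finset.mem_range.1 hn)) 1
              rw [Finset.sum_congr rfl h1]
              simp
          _ ≤ _ := ENNReal.sum_le_tsum _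
    _ = ∑' n : ℕ, μ {ω | (n : ℝ) < X ω} := by
        rw [lintegral_tsum fun n => (measurable_one.indicator (hs n)).aemeasurable]
        exact tsum_congr fun n => lintegral_indicator_one (hs n)

theorem iIndepSet_preimage_of_iIndepFun [IsProbabilityMeasure μ] {X : ℕ → Ω → ℝ}
    (hX : ∀ n, Measurable (X n)) (hi : iIndepFun X μ) {s : ℕ → Set ℝ}
    (hs : ∀ n, MeasurableSet (s n)) : iIndepSet (fun n => X n ⁻¹' s n) μ := by
  rw [iIndepSet_iff_meas_biInter fun n => hX n (hs n)]
  intro t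
  exact hi.measure_inter_preimage_eq_mul t fun i _ => hs i

/-- Almost surely, an i.i.d. sequence of marks overtakes the arrival times infinitely often, or
the gaps tend to infinity. -/
theorem IsUnitPoissonArrivals.exists_le_or_tendsto [IsProbabilityMeasure μ] {A V : ℕ → Ω → ℝ}
    (hA : IsUnitPoissonArrivals A μ) (hVm : ∀ n, Measurable (V n)) (hVi : iIndepFun V μ)
    (hVd : ∀ n, IdentDistrib (V n) (V 0) μ μ) :
    ∀ᵐ ω ∂μ, (∃ n, A n ω ≤ V n ω) ∨ Tendsto (fun n => A n ω - V n ω) atTop atTop := by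
  obtain ⟨c, hc, hlim⟩ := hA.exists_tendsto
  have hmeas : ∀ (n : ℕ) (r : ℝ), μ {ω | r < V n ω} = μ {ω | r < V 0 ω} := fun n r =>
    (hVd n).measure_mem_eq measurableSet_Ioi
  -- Since `A n ≈ c * (n + 1)`, the slope `2 * c` lies safely above the arrivals. If this series
  -- diverges, the second Borel-Cantelli lemma gives infinitely many marks above it.
  by_cases h : ∑' n : ℕ, μ {ω | 2 * c * (n + 1 : ℕ) < V n ω} = ⊤
  · have hind : iIndepSet (fun n : ℕ => {ω | 2 * c * (n + 1 : ℕ) < V n ω}) μ :=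
      iIndepSet_preimage_of_iIndepFun hVm hVi
        (s := fun n => Set.Ioi (2 * c * (n + 1 : ℕ))) fun n => measurableSet_Ioi
    have hmS : ∀ n : ℕ, MeasurableSet {ω | 2 * c * (n + 1 : ℕ) < V n ω} := fun n =>
      measurableSet_lt measurable_const (hVm n)
    have h1 := measure_limsup_eq_one hmS hind h
    have h2 : ∀ᵐ ω ∂μ, ω ∈ limsup (fun n : ℕ => {ω | 2 * c * (n + 1 : ℕ) < V n ω}) atTop :=
      (mem_ae_iff_prob_eq_one (MeasurableSet.measurableSet_limsup hmS)).2 h1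
    filter_upwards [h2, hlim] with ω hω hl
    left
    rw [mem_limsup_iff_frequently_mem] at hω
    have hev : ∀ᶠ n : ℕ in atTop, A n ω / ((n + 1 : ℕ) : ℝ) < 2 * c :=
      hl.eventually_lt_const (by linarith)
    obtain ⟨n, hn, hn'⟩ := (hω.and_eventually hev).exists
    refine ⟨n, ?_⟩
    rw [div_lt_iff₀ (by positivity)] at hn'
    exact (hn'.trans hn).le
  · set X : Ω → ℝ := fun ω => max (V 0 ω) 0 / (2 * c) with hXdef
    have hXm : Measurable X := ((hVm 0).max measurable_const).div_const _
    have hX0 : ∀ ω, 0 ≤ X ω := fun ω => by positivity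
    have hset : ∀ n : ℕ, ∀ ω, (((n + 1 : ℕ) : ℝ) < X ω) → 2 * c * (n + 1 : ℕ) < V 0 ω := by
      intro n ω hω
      rw [hXdef, lt_div_iff₀ (by positivity)] at hω
      rcases lt_max_iff.1 hω with h3 | h3
      · linarith
      · exact absurd h3 (not_lt.2 (by positivity))
    have hint : Integrable X μ := by
      refine integrable_of_tsum_tail_ne_top hXm hX0 ?_
      rw [tsum_eq_zero_add' ENNReal.summable]
      refine ENNReal.add_ne_top.2 ⟨measure_ne_top _ _, ne_top_of_le_ne_top h ?_⟩
      refine ENNReal.tsum_le_tsum fun n => ?_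
      rw [hmeas n]
      exact measure_mono fun ω hω => hset n ω hω
    -- Integrability does not depend on scale: with `4 * X = 2 * V⁺ / c` the summable tails pass
    -- from slope `2 * c` down to `c / 2`, below the arrivals.
    have hsum : ∑' n : ℕ, μ {ω | c / 2 * (n : ℝ) < V n ω} ≠ ⊤ := by
      let _ : MeasureSpace Ω := ⟨μ⟩
      have hlt := tsum_prob_mem_Ioi_lt_top (X := fun ω => 4 * X ω) (hint.const_mul 4)
        fun ω => mul_nonneg (by norm_num) (hX0 ω)
      refine ne_top_of_le_ne_top hlt.ne (ENNReal.tsum_le_tsum fun n => ?_)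
      rw [hmeas n]
      refine measure_mono fun ω hω => ?_
      have hω' : c / 2 * (n : ℝ) < V 0 ω := hω
      have h4 : 4 * X ω = max (V 0 ω) 0 * (2 / c) := by
        rw [hXdef]; field_simp; ring
      show (n : ℝ) < 4 * X ω
      rw [h4]
      calc (n : ℝ) = c / 2 * n * (2 / c) := by field_simp
        _ < V 0 ω * (2 / c) := by gcongr
        _ ≤ _ := by gcongr; exact le_max_left _ _
    filter_upwards [ae_eventually_notMem hsum, hlim] with ω hω hl
    right
    have hev : ∀ᶠ n : ℕ in atTop, 3 / 4 * c < A n ω / ((n + 1 : ℕ) : ℝ) :=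
      hl.eventually_const_lt (by linarith)
    have ht : Tendsto (fun n : ℕ => c / 4 * (n : ℝ)) atTop atTop :=
      tendsto_natCast_atTop_atTop.const_mul_atTop (by positivity)
    -- Eventually the arrivals exceed `3c/4 * n` and the marks stay below `c/2 * n`, leaving a gap
    -- of `c/4 * n`.
    refine tendsto_atTop_mono' _ ?_ ht
    filter_upwards [hω, hev] with n h5 h6
    rw [lt_div_iff₀ (by positivity)] at h6
    have h5' := not_lt.1 h5
    push_cast at h6
    show c / 4 * (n : ℝ) ≤ A n ω - V n ω
    nlinarith

/-- A mark that reaches its time has gap zero, the least possible; gaps tending to infinity leave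
finitely many competitors. -/
theorem exists_forall_le_of_exists_le_or_tendsto {a v : ℕ → ℝ}
    (h : (∃ n, a n ≤ v n) ∨ Tendsto (fun n => a n - v n) atTop atTop) :
    ∃ n, ∀ m, max (a n - v n) 0 ≤ max (a m - v m) 0 := by
  rcases h with ⟨n, hn⟩ | h
  · exact ⟨n, fun m => by rw [max_eq_right (by linarith)]; exact le_max_right _ _⟩
  · have h' : Tendsto (fun n => max (a n - v n) 0) cofinite atTop := by
      rw [Nat.cofinite_eq_atTop]
      exact tendsto_atTop_mono (fun n => le_max_left _ _) h
    exact h'.exists_forall_le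

end Arrivals

/-! ### The knapsack problem for a nonnegative random variable -/

section Knapsack

variable {Ω : Type*} [MeasurableSpace Ω] {μ : Measure Ω} [IsProbabilityMeasure μ] {m : Ω → ℝ}

theorem norm_indicator_sublevel_le {Ω : Type*} {m : Ω → ℝ} (h0 : ∀ ω, 0 ≤ m ω) (t : ℝ) (ω : Ω) :
    ‖{ω | m ω ≤ t}.indicator m ω‖ ≤ |t| := by
  by_cases h : ω ∈ {ω | m ω ≤ t}
  · rw [Set.indicator_of_mem h, Real.norm_of_nonneg (h0 ω)]
    exact le_trans h (le_abs_self t)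
  · rw [Set.indicator_of_notMem h, norm_zero]
    exact abs_nonneg t

theorem integrable_indicator_sublevel (hm : Measurable m) (h0 : ∀ ω, 0 ≤ m ω) (t : ℝ) :
    Integrable ({ω | m ω ≤ t}.indicator m) μ :=
  Integrable.of_bound (hm.indicator (measurableSet_le hm measurable_const)).aestronglyMeasurable
    |t| (ae_of_all _ (norm_indicator_sublevel_le h0 t))

/-- Dominated convergence: the integrand jumps at `t₀` only where `m = t₀`. An atom of `m` at zero
is harmless because it contributes nothing to the integral. -/
theorem continuous_integral_indicator_sublevel (hm : Measurable m) (h0 : ∀ ω, 0 ≤ m ω)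
    (hatom : ∀ c, 0 < c → μ {ω | m ω = c} = 0) :
    Continuous fun t => ∫ ω, {ω | m ω ≤ t}.indicator m ω ∂μ := by
  refine continuous_iff_continuousAt.2 fun t₀ => ?_
  refine continuousAt_of_dominated (bound := fun _ => |t₀| + 1) ?_ ?_ (integrable_const _) ?_
  · exact Eventually.of_forall fun t =>
      (hm.indicator (measurableSet_le hm measurable_const)).aestronglyMeasurable
  · filter_upwards [Metric.ball_mem_nhds t₀ one_pos] with t ht
    refine ae_of_all _ fun ω => (norm_indicator_sublevel_le h0 t ω).trans ?_
    rw [Metric.mem_ball, Real.dist_eq] at ht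
    linarith [abs_sub_abs_le_abs_sub t t₀]
  · have h1 : ∀ᵐ ω ∂μ, m ω = 0 ∨ m ω ≠ t₀ := by
      rcases le_or_gt t₀ 0 with h | h
      · refine ae_of_all _ fun ω => ?_
        by_contra! h2
        exact h2.1 (le_antisymm (h2.2.trans_le h) (h0 ω))
      · filter_upwards [measure_eq_zero_iff_ae_notMem.1 (hatom t₀ h)] with ω hω using Or.inr hω
    filter_upwards [h1] with ω hω
    by_cases hz : m ω = 0
    · have : (fun t => {ω | m ω ≤ t}.indicator m ω) = fun _ => 0 := by
        funext t
        by_cases h : ω ∈ {ω | m ω ≤ t}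
        · rw [Set.indicator_of_mem h, hz]
        · rw [Set.indicator_of_notMem h]
      rw [this]
      exact continuousAt_const
    · rcases lt_or_gt_of_ne (hω.resolve_left hz) with h | h
      · refine (continuousAt_const (y := m ω)).congr ?_
        filter_upwards [lt_mem_nhds h] with t ht
        exact (Set.indicator_of_mem (s := {ω | m ω ≤ t}) ht.le m).symm
      · refine (continuousAt_const (y := (0 : ℝ))).congr ?_
        filter_upwards [gt_mem_nhds h] with t ht
        exact (Set.indicator_of_notMem (s := {ω | m ω ≤ t}) (not_le.2 ht) m).symm

theorem integral_max_one_sub (hm : Measurable m) (h0 : ∀ ω, 0 ≤ m ω) {t : ℝ} (ht : 0 < t) :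
    ∫ ω, max (1 - t⁻¹ * m ω) 0 ∂μ =
      μ.real {ω | m ω ≤ t} - t⁻¹ * ∫ ω, {ω | m ω ≤ t}.indicator m ω ∂μ := by
  have hs : MeasurableSet {ω | m ω ≤ t} := measurableSet_le hm measurable_const
  rw [← integral_indicator_one hs, ← integral_const_mul, ← integral_sub]
  · congr 1 with ω
    have h1 : t⁻¹ * m ω ≤ 1 ↔ m ω ≤ t := by rw [inv_mul_le_iff₀ ht, mul_one]
    by_cases h : ω ∈ {ω | m ω ≤ t}
    · rw [Set.indicator_of_mem h, Set.indicator_of_mem h, Pi.one_apply, max_eq_left]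
      linarith [h1.2 h]
    · rw [Set.indicator_of_notMem h, Set.indicator_of_notMem h, mul_zero, sub_zero, max_eq_right]
      linarith [not_le.1 fun h2 => h (h1.1 h2)]
  · exact (integrable_const 1).indicator hs
  · exact (integrable_indicator_sublevel hm h0 t).const_mul _

/-- A sublevel set of `m` of almost maximal probability among the events on which `m` has mean at
most `δ`. -/
theorem exists_sublevel (hm : Measurable m) (h0 : ∀ ω, 0 ≤ m ω)
    (hatom : ∀ c, 0 < c → μ {ω | m ω = c} = 0) {δ D ε : ℝ} (hδ : 0 < δ) (hε : 0 < ε)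
    (hD : ∀ l : ℝ, 0 ≤ l → D ≤ l * δ + ∫ ω, max (1 - l * m ω) 0 ∂μ) :
    ∃ t : ℝ, ∫ ω, {ω | m ω ≤ t}.indicator m ω ∂μ ≤ δ ∧ D - ε ≤ μ.real {ω | m ω ≤ t} := by
  set G : ℝ → ℝ := fun t => ∫ ω, {ω | m ω ≤ t}.indicator m ω ∂μ
  have hG0 : ∀ t, 0 ≤ G t := fun t =>
    integral_nonneg fun ω => Set.indicator_nonneg (fun ω _ => h0 ω) ω
  have hbound : ∀ t : ℝ, 0 < t → D ≤ t⁻¹ * δ + (μ.real {ω | m ω ≤ t} - t⁻¹ * G t) :=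
    fun t ht => by
      rw [← integral_max_one_sub hm h0 ht]
      exact hD t⁻¹ (inv_nonneg.2 ht.le)
  have hT : 0 < δ / ε := div_pos hδ hε
  -- At `t = δ / ε` the penalty `t⁻¹ * δ` is exactly `ε`, so if this level is affordable it already
  -- suffices.
  by_cases h : G (δ / ε) ≤ δ
  · refine ⟨δ / ε, h, ?_⟩
    have h1 := hbound _ hT
    have h2 : (δ / ε)⁻¹ * δ = ε := by field_simp
    have h3 : 0 ≤ (δ / ε)⁻¹ * G (δ / ε) := mul_nonneg (inv_nonneg.2 hT.le) (hG0 _)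
    linarith
  · have hGz : G 0 = 0 := by
      rw [show G 0 = ∫ _, (0 : ℝ) ∂μ from integral_congr_ae (ae_of_all _ fun ω => ?_), integral_zero]
      exact norm_le_zero_iff.1 ((norm_indicator_sublevel_le h0 0 ω).trans abs_zero.le)
    -- Otherwise some level spends exactly `δ`, and the two terms in `t⁻¹` cancel.
    obtain ⟨t, ht, htδ⟩ := intermediate_value_Icc hT.le
      (continuous_integral_indicator_sublevel hm h0 hatom).continuousOn
      (show δ ∈ Set.Icc (G 0) (G (δ / ε)) from ⟨hGz.trans_le hδ.le, (not_le.1 h).le⟩)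
    have htδ' : G t = δ := htδ
    have ht0 : 0 < t := by
      refine lt_of_le_of_ne ht.1 fun h2 => hδ.ne ?_
      rw [← htδ', ← h2, hGz]
    refine ⟨t, htδ'.le, ?_⟩
    have h1 := hbound t ht0
    rw [htδ'] at h1
    linarith

/-- The case of zero budget: as `l → ∞`, `(1 - l * m)⁺` decreases to the indicator of `m = 0`. -/
theorem le_measureReal_nonpos (hm : Measurable m) (h0 : ∀ ω, 0 ≤ m ω) {D : ℝ}
    (hD : ∀ l : ℝ, 0 ≤ l → D ≤ ∫ ω, max (1 - l * m ω) 0 ∂μ) : D ≤ μ.real {ω | m ω ≤ 0} := by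
  have hs : MeasurableSet {ω | m ω ≤ 0} := measurableSet_le hm measurable_const
  rw [← integral_indicator_one hs]
  refine ge_of_tendsto' (tendsto_integral_of_dominated_convergence (bound := fun _ => 1)
    (F := fun (k : ℕ) ω => max (1 - k * m ω) 0) (fun k => ?_) (integrable_const _)
    (fun k => ae_of_all _ fun ω => ?_) (ae_of_all _ fun ω => ?_)) fun k : ℕ => hD k k.cast_nonneg
  · exact (Measurable.max (measurable_const.sub (hm.const_mul _)) measurable_const).aestronglyMeasurable
  · rw [Real.norm_of_nonneg (le_max_right _ _)]
    refine max_le ?_ zero_le_one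
    linarith [mul_nonneg (Nat.cast_nonneg (α := ℝ) k) (h0 ω)]
  · by_cases h : m ω ≤ 0
    · rw [Set.indicator_of_mem (s := {ω | m ω ≤ 0}) h]
      simp [le_antisymm h (h0 ω)]
    · rw [Set.indicator_of_notMem (s := {ω | m ω ≤ 0}) h]
      push Not at h
      refine tendsto_const_nhds.congr' ?_
      have h1 : Tendsto (fun k : ℕ => (k : ℝ) * m ω) atTop atTop :=
        tendsto_natCast_atTop_atTop.atTop_mul_const h
      filter_upwards [h1.eventually_ge_atTop 1] with k hk
      rw [max_eq_right (by linarith)]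

end Knapsack

/-! ### Transporting a near-minimizing atom -/

section Transport

variable {Ω : Type*} [MeasurableSpace Ω] {μ : Measure Ω}

/-- Both measures are built on the same probability space, which supplies the coupling. -/
theorem wasserstein_map_le {S : Type*} [MeasurableSpace S] (c : S → S → ℝ≥0∞)
    {f g : Ω → Measure S} (hf : Measurable f) (hg : Measurable g) :
    wasserstein c (μ.map f) (μ.map g) ≤ ∫⁻ ω, matchingCost c (f ω) (g ω) ∂μ := by
  refine (iInf_le _ (μ.map fun ω => (f ω, g ω))).trans <|
    (iInf_le _ (Measure.fst_map_prodMk hg)).trans <|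
    (iInf_le _ (Measure.snd_map_prodMk hf)).trans ?_
  exact lintegral_map_le (fun z : Measure S × Measure S => matchingCost c z.1 z.2) _

theorem measurable_spectral {d : ℕ} (x : Fin d → ℝ) : Measurable (spectral x) :=
  Measurable.iSup fun k => (measurable_pi_apply k).mul_const _

theorem measurable_planarProcess {d : ℕ} (x : Fin d → ℝ) : Measurable (planarProcess x) :=
  measurable_pointMeasure fun n => (measurable_fst.comp (measurable_pi_apply n)).prodMk
    ((measurable_spectral x).comp (measurable_snd.comp (measurable_pi_apply n)))

theorem lt_spectral_iff {d : ℕ} {x y : Fin d → ℝ} (hd : 1 ≤ d) {a : ℝ} :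
    a < spectral x y ↔ ∃ k, a < y k * x k := by
  have : Nonempty (Fin d) := ⟨⟨0, hd⟩⟩
  exact lt_ciSup_iff (Set.finite_range _).bddAbove

theorem spectral_const_div {d : ℕ} {x : Fin d → ℝ} (hd : 1 ≤ d) (hx : ∀ k, 0 < x k) (v : ℝ) :
    spectral x (fun k => v / x k) = v := by
  have : Nonempty (Fin d) := ⟨⟨0, hd⟩⟩
  simp only [spectral, div_mul_cancel₀ _ (hx _).ne', ciSup_const]

/-- The smallest gap `min_n (a n - v n)⁺`. -/
noncomputable def minGap (a v : ℕ → ℝ) : ℝ := ⨅ n, max (a n - v n) 0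

theorem bddBelow_gap (a v : ℕ → ℝ) : BddBelow (Set.range fun n => max (a n - v n) 0) :=
  ⟨0, by rintro _ ⟨n, rfl⟩; exact le_max_right _ _⟩

theorem minGap_nonneg (a v : ℕ → ℝ) : 0 ≤ minGap a v := le_ciInf fun _ => le_max_right _ _

theorem minGap_le (a v : ℕ → ℝ) (n : ℕ) : minGap a v ≤ max (a n - v n) 0 :=
  ciInf_le (bddBelow_gap a v) n

theorem measurable_minGap {A V : ℕ → Ω → ℝ} (hA : ∀ n, Measurable (A n))
    (hV : ∀ n, Measurable (V n)) : Measurable fun ω => minGap (fun n => A n ω) fun n => V n ω :=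
  Measurable.iInf fun n => ((hA n).sub (hV n)).max measurable_const

theorem ofReal_minGap_le_gapInf (a v : ℕ → ℝ) :
    ENNReal.ofReal (minGap a v) ≤ gapInf (pointMeasure fun n => (a n, v n)) := by
  rcases (minGap_nonneg a v).eq_or_lt with h | h
  · simp [← h]
  · refine ofReal_le_gapInf ?_
    by_contra h1
    obtain ⟨n, hn⟩ := (pointMeasure_apply_ne_zero_iff (measurableSet_gap_lt _)).1 h1
    exact (minGap_le a v n).not_gt (max_lt hn h)

/-- The slack `η` makes the first admissible index exist for every `ω`, whereas a true minimizer
exists only almost surely. -/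
theorem exists_measurable_near_minimizer {A V : ℕ → Ω → ℝ} (hA : ∀ n, Measurable (A n))
    (hV : ∀ n, Measurable (V n)) {η : ℝ} (hη : 0 < η) :
    ∃ τ : Ω → ℕ, Measurable τ ∧ ∀ ω, max (A (τ ω) ω - V (τ ω) ω) 0 <
      minGap (fun n => A n ω) (fun n => V n ω) + η := by
  classical
  have h : ∀ ω, ∃ n, max (A n ω - V n ω) 0 <
      minGap (fun n => A n ω) (fun n => V n ω) + η := fun ω =>
    exists_lt_of_ciInf_lt (lt_add_of_pos_right (minGap (fun n => A n ω) fun n => V n ω) hη)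
  refine ⟨fun ω => Nat.find (h ω), measurable_find h fun k => ?_, fun ω => Nat.find_spec (h ω)⟩
  exact measurableSet_lt (((hA k).sub (hV k)).max measurable_const)
    ((measurable_minGap hA hV).add_const η)

/-- The sequences of times and marks with positive times and a point overtaking its time. -/
def overtaken {d : ℕ} (x : Fin d → ℝ) : Set (ℕ → ℝ × (Fin d → ℝ)) :=
  {z | (∀ n, 0 < (z n).1) ∧ ∃ n, (z n).1 < spectral x (z n).2}

theorem measurableSet_overtaken {d : ℕ} (x : Fin d → ℝ) : MeasurableSet (overtaken x) := by
  have h1 : ∀ n, Measurable fun z : ℕ → ℝ × (Fin d → ℝ) => (z n).1 := fun n =>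
    measurable_fst.comp (measurable_pi_apply n)
  have h2 : ∀ n, Measurable fun z : ℕ → ℝ × (Fin d → ℝ) => spectral x (z n).2 := fun n =>
    (measurable_spectral x).comp (measurable_snd.comp (measurable_pi_apply n))
  have : overtaken x = (⋂ n, {z | 0 < (z n).1}) ∩ ⋃ n, {z | (z n).1 < spectral x (z n).2} := by
    ext z; simp [overtaken]
  rw [this]
  exact (MeasurableSet.iInter fun n => measurableSet_lt measurable_const (h1 n)).inter
    (MeasurableSet.iUnion fun n => measurableSet_lt (h1 n) (h2 n))

/-- Push one near-minimizing point of the process over its time, on the event `B`. -/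
theorem exists_transport [IsProbabilityMeasure μ] {d : ℕ} (hd : 1 ≤ d) {x : Fin d → ℝ}
    (hx : ∀ k, 0 < x k) {A : ℕ → Ω → ℝ} {Y : ℕ → Ω → Fin d → ℝ} (hA : ∀ n, Measurable (A n))
    (hY : ∀ n, Measurable (Y n)) (hpos : ∀ᵐ ω ∂μ, ∀ n, 0 < A n ω) {B : Set Ω}
    (hB : MeasurableSet B) {η : ℝ} (hη : 0 < η) :
    ∃ z : Ω → ℕ → ℝ × (Fin d → ℝ), Measurable z ∧
      wasserstein fixedTimeCost ((μ.map z).map (planarProcess x))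
        (μ.map fun ω => planarProcess x fun n => (A n ω, Y n ω)) ≤
        ∫⁻ ω, B.indicator (fun ω => ENNReal.ofReal
          (minGap (fun n => A n ω) (fun n => spectral x (Y n ω)) + 2 * η)) ω ∂μ ∧
      μ.real B ≤ (μ.map z).real (overtaken x) := by
  classical
  have hV : ∀ n, Measurable fun ω => spectral x (Y n ω) := fun n =>
    (measurable_spectral x).comp (hY n)
  obtain ⟨τ, hτ, hτlt⟩ := exists_measurable_near_minimizer hA hV hη
  -- The maximum ensures that a mark is only ever raised, and that it ends strictly above its time.
  let v : ℕ → Ω → ℝ := fun n ω => max (spectral x (Y n ω)) (A n ω + η)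
  have hv : ∀ n, Measurable (v n) := fun n => (hV n).max ((hA n).add_const η)
  let F : ℕ → Set Ω := fun n => {ω | ω ∈ B ∧ τ ω = n}
  have hF : ∀ n, MeasurableSet (F n) := fun n => hB.inter (hτ (measurableSet_singleton n))
  -- The mark with coordinates `v / x k` has spectral coordinate exactly `v`, so the planar move
  -- lifts to sequences of vectors.
  let z : Ω → ℕ → ℝ × (Fin d → ℝ) := fun ω n =>
    (A n ω, if ω ∈ F n then fun k => v n ω / x k else Y n ω)
  have hz : Measurable z := measurable_pi_lambda _ fun n => (hA n).prodMk <|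
    Measurable.ite (hF n) (measurable_pi_lambda _ fun k => (hv n).div_const _) (hY n)
  have hz0 : Measurable fun ω n => (A n ω, Y n ω) :=
    measurable_pi_lambda _ fun n => (hA n).prodMk (hY n)
  refine ⟨z, hz, ?_, ?_⟩
  · rw [Measure.map_map (measurable_planarProcess x) hz]
    refine (wasserstein_map_le _ ((measurable_planarProcess x).comp hz)
      ((measurable_planarProcess x).comp hz0)).trans (lintegral_mono fun ω => ?_)
    refine (matchingCost_pointMeasure_le _ _ _).trans ?_
    have hne : ∀ n, ω ∉ F n → fixedTimeCost ((z ω n).1, spectral x (z ω n).2)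
        (A n ω, spectral x (Y n ω)) = 0 := fun n hn => by
      simp [fixedTimeCost, z, hn]
    by_cases hω : ω ∈ B
    · rw [tsum_eq_single (τ ω) fun n hn => hne n fun h => hn h.2.symm, Set.indicator_of_mem hω]
      have hmem : ω ∈ F (τ ω) := ⟨hω, rfl⟩
      simp only [fixedTimeCost, z, if_pos hmem, spectral_const_div hd hx, v, if_true]
      refine ENNReal.ofReal_le_ofReal ?_
      have h1 := hτlt ω
      -- One `η` pays for near-minimality, the other for passing strictly beyond the time.
      have h2 := le_max_left (A (τ ω) ω - spectral x (Y (τ ω) ω)) 0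
      have h3 := minGap_nonneg (fun n => A n ω) (fun n => spectral x (Y n ω))
      rw [abs_of_nonneg (sub_nonneg.2 (le_max_left _ _)), sub_le_iff_le_add]
      refine max_le ?_ ?_ <;> linarith
    · rw [ENNReal.tsum_eq_zero.2 fun n => hne n fun h => hω h.1]
      exact zero_le
  · rw [map_measureReal_apply hz (measurableSet_overtaken x)]
    refine ENNReal.toReal_mono (measure_ne_top _ _) (measure_mono_ae ?_)
    filter_upwards [hpos] with ω hω hωB
    refine ⟨hω, τ ω, ?_⟩
    have hmem : ω ∈ F (τ ω) := ⟨hωB, rfl⟩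
    simp only [z, if_pos hmem, spectral_const_div hd hx, v]
    exact lt_max_of_lt_right (by linarith)

end Transport

/-! ### Strong and weak duality over the ball -/

section Duality

variable {Ω : Type*} [MeasurableSpace Ω] {μ : Measure Ω}

theorem exists_eq_minGap {a v : ℕ → ℝ} (h : ∃ n, ∀ m, max (a n - v n) 0 ≤ max (a m - v m) 0) :
    ∃ n, max (a n - v n) 0 = minGap a v := by
  obtain ⟨n, hn⟩ := h
  exact ⟨n, le_antisymm (le_ciInf hn) (minGap_le a v n)⟩

/-- A law of sequences whose planar process lies within `δ` of the reference one and almost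
attains the dual value `D`. -/
theorem exists_near_optimal [IsProbabilityMeasure μ] {d : ℕ} (hd : 1 ≤ d) {x : Fin d → ℝ}
    (hx : ∀ k, 0 < x k) {A : ℕ → Ω → ℝ} {Y : ℕ → Ω → Fin d → ℝ} (hA : ∀ n, Measurable (A n))
    (hY : ∀ n, Measurable (Y n)) (hpos : ∀ᵐ ω ∂μ, ∀ n, 0 < A n ω)
    (hatt : ∀ᵐ ω ∂μ, ∃ n, ∀ m,
      max (A n ω - spectral x (Y n ω)) 0 ≤ max (A m ω - spectral x (Y m ω)) 0)
    (hne : ∀ c, ∀ᵐ ω ∂μ, ∀ n, A n ω ≠ spectral x (Y n ω) + c) {δ D ε : ℝ} (hδ : 0 ≤ δ)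
    (hε : 0 < ε)
    (hD : ∀ l : ℝ, 0 ≤ l → D ≤ l * δ +
      ∫ ω, max (1 - l * minGap (fun n => A n ω) fun n => spectral x (Y n ω)) 0 ∂μ) :
    ∃ P' : Measure (ℕ → ℝ × (Fin d → ℝ)), IsProbabilityMeasure P' ∧
      P'.map (planarProcess x) ∈ ball (μ.map fun ω => planarProcess x fun n => (A n ω, Y n ω)) δ ∧
      D - ε ≤ P'.real (overtaken x) := by
  have hV : ∀ n, Measurable fun ω => spectral x (Y n ω) := fun n =>
    (measurable_spectral x).comp (hY n)
  set m : Ω → ℝ := fun ω => minGap (fun n => A n ω) fun n => spectral x (Y n ω)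
  have hm : Measurable m := measurable_minGap hA hV
  have h0 : ∀ ω, 0 ≤ m ω := fun ω => minGap_nonneg _ _
  have hball : ∀ z : Ω → ℕ → ℝ × (Fin d → ℝ), Measurable z →
      IsProbabilityMeasure ((μ.map z).map (planarProcess x)) := fun z hz => by
    have := Measure.isProbabilityMeasure_map (μ := μ) hz.aemeasurable
    exact Measure.isProbabilityMeasure_map (measurable_planarProcess x).aemeasurable
  rcases hδ.eq_or_lt with rfl | hδ
  -- With no budget the reference law itself serves: `m = 0` forces some `A n ≤ V n`, and ties are
  -- null.
  · have hz : Measurable fun ω n => (A n ω, Y n ω) :=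
      measurable_pi_lambda _ fun n => (hA n).prodMk (hY n)
    refine ⟨μ.map fun ω n => (A n ω, Y n ω), Measure.isProbabilityMeasure_map hz.aemeasurable,
      ⟨hball _ hz, ?_⟩, ?_⟩
    · rw [Measure.map_map (measurable_planarProcess x) hz]
      have hf := (measurable_planarProcess x).comp hz
      refine (wasserstein_map_le _ hf hf).trans ?_
      rw [ENNReal.ofReal_zero, nonpos_iff_eq_zero]
      refine (lintegral_congr fun ω => ?_).trans lintegral_zero
      refine nonpos_iff_eq_zero.1 ((matchingCost_pointMeasure_le _ _ _).trans ?_)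
      simp [fixedTimeCost]
    · have h1 : D ≤ μ.real {ω | m ω ≤ 0} :=
        le_measureReal_nonpos hm h0 fun l hl => by simpa using hD l hl
      rw [map_measureReal_apply hz (measurableSet_overtaken x)]
      refine ((sub_le_self D hε.le).trans h1).trans
        (ENNReal.toReal_mono (measure_ne_top _ _) (measure_mono_ae ?_))
      filter_upwards [hpos, hatt, hne 0] with ω h2 h3 h4 (h5 : m ω ≤ 0)
      obtain ⟨n, hn⟩ := exists_eq_minGap h3
      refine ⟨h2, n, lt_of_le_of_ne ?_ (by simpa using h4 n)⟩
      exact sub_nonpos.1 ((le_max_left _ _).trans (hn.trans_le h5))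
  · have hatom : ∀ c, 0 < c → μ {ω | m ω = c} = 0 := fun c hc => by
      rw [measure_eq_zero_iff_ae_notMem]
      filter_upwards [hatt, hne c] with ω h3 h4 (h5 : m ω = c)
      obtain ⟨n, hn⟩ := exists_eq_minGap h3
      have h6 : max (A n ω - spectral x (Y n ω)) 0 = c := hn.trans h5
      refine h4 n ?_
      rcases max_choice (A n ω - spectral x (Y n ω)) 0 with h7 | h7 <;> rw [h7] at h6 <;> linarith
    have hD1 : D ≤ 1 := by simpa using hD 0 le_rfl
    -- The fraction `θ` of the budget is reserved for the surplus `2 * η = θ * δ` of the transport.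
    -- As `D ≤ 1`, this lowers the value by at most `θ ≤ ε / 2`.
    set θ : ℝ := min (ε / 2) (1 / 2)
    have hθ : 0 < θ := lt_min (by linarith) (by norm_num)
    have hθ1 : θ ≤ 1 / 2 := min_le_right _ _
    have hθε : θ ≤ ε / 2 := min_le_left _ _
    obtain ⟨t, ht, htD⟩ := exists_sublevel (δ := (1 - θ) * δ) (D := (1 - θ) * D) (ε := ε / 2)
      hm h0 hatom (mul_pos (by linarith) hδ) (by linarith) fun l hl => by
        have hI : 0 ≤ ∫ ω, max (1 - l * m ω) 0 ∂μ := integral_nonneg fun ω => le_max_right _ _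
        have := mul_le_mul_of_nonneg_left (hD l hl) (show 0 ≤ 1 - θ by linarith)
        nlinarith [mul_nonneg hθ.le hI]
    have hB : MeasurableSet {ω | m ω ≤ t} := measurableSet_le hm measurable_const
    obtain ⟨z, hz, hW, hE⟩ := exists_transport hd hx hA hY hpos hB
      (show 0 < θ * δ / 2 by positivity)
    refine ⟨μ.map z, Measure.isProbabilityMeasure_map hz.aemeasurable,
      ⟨hball z hz, hW.trans ?_⟩, le_trans ?_ hE⟩
    · calc _ ≤ ∫⁻ ω, (ENNReal.ofReal ({ω | m ω ≤ t}.indicator m ω) +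
            ENNReal.ofReal (θ * δ)) ∂μ := by
            refine lintegral_mono fun ω => ?_
            by_cases h : ω ∈ {ω | m ω ≤ t}
            · rw [Set.indicator_of_mem h, Set.indicator_of_mem h,
                ← ENNReal.ofReal_add (h0 ω) (by positivity)]
              exact ENNReal.ofReal_le_ofReal (add_le_add_right (by linarith) _)
            · rw [Set.indicator_of_notMem h]
              exact zero_le
        _ = ENNReal.ofReal (∫ ω, {ω | m ω ≤ t}.indicator m ω ∂μ) + ENNReal.ofReal (θ * δ) := by
            rw [lintegral_add_right _ measurable_const, lintegral_const, measure_univ, mul_one,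
              ofReal_integral_eq_lintegral_ofReal (integrable_indicator_sublevel hm h0 t)
                (ae_of_all _ fun ω => Set.indicator_nonneg (fun ω _ => h0 ω) ω)]
        _ ≤ ENNReal.ofReal ((1 - θ) * δ) + ENNReal.ofReal (θ * δ) := by gcongr
        _ = ENNReal.ofReal δ := by
            rw [← ENNReal.ofReal_add (mul_nonneg (by linarith) hδ.le) (by positivity)]
            ring_nf
    · nlinarith

/-- Weak duality over the ball. -/
theorem measureReal_exists_le_le [IsProbabilityMeasure μ] {A V : ℕ → Ω → ℝ}
    (hA : ∀ n, Measurable (A n)) (hV : ∀ n, Measurable (V n)) {δ : ℝ} (hδ : 0 ≤ δ) {P : Measure (Measure (ℝ × ℝ))}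
    (hP : P ∈ ball (μ.map fun ω => pointMeasure fun n => (A n ω, V n ω)) δ) {l : ℝ} (hl : 0 ≤ l) :
    P.real {N | N {p | p.1 ≤ p.2} ≠ 0} ≤
      l * δ + ∫ ω, max (1 - l * minGap (fun n => A n ω) fun n => V n ω) 0 ∂μ := by
  set m : Ω → ℝ := fun ω => minGap (fun n => A n ω) fun n => V n ω
  have hm : Measurable m := measurable_minGap hA hV
  have hm' : Measurable fun ω => max (1 - l * m ω) 0 :=
    (measurable_const.sub (hm.const_mul _)).max measurable_const
  have h0 : ∀ ω, 0 ≤ m ω := fun ω => minGap_nonneg _ _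
  have hint : Integrable (fun ω => max (1 - l * m ω) 0) μ := by
    refine Integrable.of_bound hm'.aestronglyMeasurable 1 (ae_of_all _ fun ω => ?_)
    rw [Real.norm_of_nonneg (le_max_right _ _)]
    exact max_le (by linarith [mul_nonneg hl (h0 ω)]) zero_le_one
  have hI : 0 ≤ ∫ ω, max (1 - l * m ω) 0 ∂μ := integral_nonneg fun ω => le_max_right _ _
  have key : ∫⁻ N, (1 - l.toNNReal * gapInf N)
      ∂(μ.map fun ω => pointMeasure fun n => (A n ω, V n ω)) ≤
      ENNReal.ofReal (∫ ω, max (1 - l * m ω) 0 ∂μ) := by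
    have hg : Measurable fun N => 1 - (l.toNNReal : ℝ≥0∞) * gapInf N :=
      measurable_const.sub (measurable_gapInf.const_mul _)
    rw [lintegral_map hg (measurable_pointMeasure fun n => (hA n).prodMk (hV n)),
      ofReal_integral_eq_lintegral_ofReal hint (ae_of_all _ fun ω => le_max_right _ _)]
    refine lintegral_mono fun ω => ?_
    calc (1 : ℝ≥0∞) - l.toNNReal * gapInf (pointMeasure fun n => (A n ω, V n ω))
        ≤ 1 - ENNReal.ofReal l * ENNReal.ofReal (m ω) :=
          tsub_le_tsub_left (mul_le_mul_right (ofReal_minGap_le_gapInf _ _) _) _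
      _ = ENNReal.ofReal (1 - l * m ω) := by
          rw [← ENNReal.ofReal_mul hl, ENNReal.ofReal_sub _ (mul_nonneg hl (h0 ω)),
            ENNReal.ofReal_one]
      _ ≤ _ := ENNReal.ofReal_le_ofReal (le_max_left _ _)
  -- The infimum defining the distance need not be attained, so weak duality is applied with `δ + ε`
  -- and then `ε → 0`.
  have hε : ∀ ε : ℝ, 0 < ε → P.real {N | N {p | p.1 ≤ p.2} ≠ 0} ≤
      l * (δ + ε) + ∫ ω, max (1 - l * m ω) 0 ∂μ := fun ε hε => by
    refine ENNReal.toReal_le_of_le_ofReal (by positivity) ?_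
    refine (measure_exists_le_le (hP.2.trans_lt
      ((ENNReal.ofReal_lt_ofReal_iff (by linarith)).2 (lt_add_of_pos_right δ hε)))
      l.toNNReal).trans ?_
    rw [ENNReal.ofReal_add (by positivity) hI, ENNReal.ofReal_mul hl]
    exact add_le_add le_rfl key
  have hlim : Tendsto (fun ε => l * (δ + ε) + ∫ ω, max (1 - l * m ω) 0 ∂μ) (𝓝[>] 0)
      (𝓝 (l * (δ + 0) + ∫ ω, max (1 - l * m ω) 0 ∂μ)) :=
    ((by fun_prop : Continuous fun ε : ℝ => l * (δ + ε) + ∫ ω, max (1 - l * m ω) 0 ∂μ).tendsto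
      0).mono_left nhdsWithin_le_nhds
  rw [add_zero] at hlim
  exact ge_of_tendsto hlim (eventually_mem_nhdsWithin.mono hε)

/-- Positive times are essential: they allow clearing the denominators in `M_k ≤ 1 / x_k`. -/
theorem forall_compMax_le_iff {d : ℕ} (hd : 1 ≤ d) {x : Fin d → ℝ} (hx : ∀ k, 0 < x k)
    {z : ℕ → ℝ × (Fin d → ℝ)} (hz : ∀ n, 0 < (z n).1) :
    (∀ k, compMax z k ≤ (((x k)⁻¹ : ℝ) : EReal)) ↔ ∀ n, spectral x (z n).2 ≤ (z n).1 := by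
  have h : ∀ n k, (((z n).2 k / (z n).1 : ℝ) : EReal) ≤ (((x k)⁻¹ : ℝ) : EReal) ↔
      (z n).2 k * x k ≤ (z n).1 := fun n k => by
    rw [EReal.coe_le_coe_iff, div_le_iff₀ (hz n), inv_mul_eq_div, le_div_iff₀ (hx k)]
  simp only [compMax, iSup_le_iff, h]
  rw [forall_comm]
  refine forall_congr' fun n => ?_
  rw [← not_lt, lt_spectral_iff hd]
  push Not
  rfl

theorem integral_loss {P : Measure (Measure (ℝ × ℝ))} :
    ∫ N, loss (∫⁻ p, failureRegion.indicator (fun _ => 1) p ∂N) ∂P =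
      P.real {N | 1 ≤ N failureRegion} := by
  have hs : MeasurableSet {N : Measure (ℝ × ℝ) | 1 ≤ N failureRegion} :=
    measurableSet_le measurable_const (Measure.measurable_coe measurableSet_failureRegion)
  rw [← integral_indicator_one hs]
  congr 1 with N
  rw [lintegral_indicator_const measurableSet_failureRegion, one_mul, loss, Set.indicator_apply]
  rfl

end Duality

end RobustCDF

/-! ### The main theorem -/

open RobustCDF

theorem theorem2 {Ω : Type*} [MeasurableSpace Ω] (μ : Measure Ω) [IsProbabilityMeasure μ]
    (d : ℕ) (hd : 1 ≤ d)
    (A : ℕ → Ω → ℝ) (hA : RobustCDF.IsUnitPoissonArrivals A μ)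
    (Y : ℕ → Ω → Fin d → ℝ) (hYm : ∀ n, Measurable (Y n))
    (hYi : iIndepFun Y μ) (hYd : ∀ n, IdentDistrib (Y n) (Y 0) μ μ)
    (hAY : IndepFun (fun ω n => A n ω) (fun ω n => Y n ω) μ)
    (x : Fin d → ℝ) (hx : ∀ k, 0 < x k)
    (V : ℕ → Ω → ℝ) (hV : ∀ n ω, V n ω = RobustCDF.spectral x (Y n ω))
    (P₀ : Measure (Measure (ℝ × ℝ)))
    (hP₀ : P₀ = μ.map fun ω => RobustCDF.pointMeasure fun n => (A n ω, V n ω))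
    (δ : ℝ) (hδ : 0 ≤ δ)
    (D : ℝ)
    (hD : D = ⨅ l : ℝ≥0,
      ((l : ℝ) * δ + ∫ ω, max (1 - (l : ℝ) * ⨅ n, max (A n ω - V n ω) 0) 0 ∂μ)) :
    -- the minimum over `n` in the dual problem is attained almost surely
    (∀ᵐ ω ∂μ, ∃ n, ∀ m, max (A n ω - V n ω) 0 ≤ max (A m ω - V m ω) 0) ∧
    -- worst case of `P'(M ≤ x⁻¹)` over the laws of sequences of times and marks whose planar
    -- point process has its law in the ball
    IsGLB {r : ℝ | ∃ P' : Measure (ℕ → ℝ × (Fin d → ℝ)), IsProbabilityMeasure P' ∧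
        P'.map (RobustCDF.planarProcess x) ∈ RobustCDF.ball P₀ δ ∧
        r = P'.real {z | ∀ k, RobustCDF.compMax z k ≤ (((x k)⁻¹ : ℝ) : EReal)}} (1 - D) ∧
    -- the same event, no point `(a, v)` with `a < v`, over all point process laws in the ball
    IsGLB {r : ℝ | ∃ P ∈ RobustCDF.ball P₀ δ,
        r = P.real {N | N {p | p.1 < p.2} = 0}} (1 - D) ∧
    -- worst-case expected loss `E_P[ℓ(N(f))]` with `f` the indicator function of the region
    IsLUB {r : ℝ | ∃ P ∈ RobustCDF.ball P₀ δ,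
        r = ∫ N, RobustCDF.loss
          (∫⁻ p, RobustCDF.failureRegion.indicator (fun _ => 1) p ∂N) ∂P} D := by

  obtain rfl : V = fun n ω => spectral x (Y n ω) := funext fun n => funext fun ω => hV n ω
  have hVm : ∀ n, Measurable fun ω => spectral x (Y n ω) := fun n =>
    (measurable_spectral x).comp (hYm n)
  have hpos := hA.ae_pos
  have hVi : iIndepFun (fun n ω => spectral x (Y n ω)) μ :=
    hYi.comp (fun _ => spectral x) fun _ => measurable_spectral x
  have hVd : ∀ n, IdentDistrib (fun ω => spectral x (Y n ω)) (fun ω => spectral x (Y 0 ω)) μ μ :=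
    fun n => (hYd n).comp (measurable_spectral x)
  have hatt : ∀ᵐ ω ∂μ, ∃ n, ∀ m,
      max (A n ω - spectral x (Y n ω)) 0 ≤ max (A m ω - spectral x (Y m ω)) 0 := by
    filter_upwards [hA.exists_le_or_tendsto hVm hVi hVd] with ω hω
    exact exists_forall_le_of_exists_le_or_tendsto hω
  -- The case `c = 0` excludes ties between marks and times; `c > 0` excludes atoms of the minimal
  -- gap.
  have hne : ∀ c, ∀ᵐ ω ∂μ, ∀ n, A n ω ≠ spectral x (Y n ω) + c := fun c => by
    refine ae_all_iff.2 fun n => measure_eq_zero_iff_ae_notMem.1 ?_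
    exact measure_eq_add_const_eq_zero (hA.measurable n) (hVm n)
      (hAY.comp (measurable_pi_apply n) ((measurable_spectral x).comp (measurable_pi_apply n)))
      (hA.map_singleton n) c
  have hDle : ∀ l : ℝ, 0 ≤ l → D ≤ l * δ +
      ∫ ω, max (1 - l * minGap (fun n => A n ω) fun n => spectral x (Y n ω)) 0 ∂μ := by
    intro l hl
    rw [hD]
    refine ciInf_le ⟨0, ?_⟩ (⟨l, hl⟩ : ℝ≥0)
    rintro _ ⟨l, rfl⟩
    exact add_nonneg (mul_nonneg l.2 hδ) (integral_nonneg fun ω => le_max_right _ _)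
  have hupper : ∀ P ∈ ball P₀ δ, P.real {N | N {p | p.1 ≤ p.2} ≠ 0} ≤ D := by
    intro P hP
    rw [hP₀] at hP
    rw [hD]
    exact le_ciInf fun l => measureReal_exists_le_le hA.measurable hVm hδ hP l.2
  have hlower : ∀ ε : ℝ, 0 < ε → ∃ P' : Measure (ℕ → ℝ × (Fin d → ℝ)), IsProbabilityMeasure P' ∧
      P'.map (planarProcess x) ∈ ball P₀ δ ∧ D - ε ≤ P'.real (overtaken x) := by
    intro ε hε
    rw [hP₀]
    exact exists_near_optimal hd hx hA.measurable hYm hpos hatt hne hδ hε hDle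
  have hP₀pos : ∀ᵐ N ∂P₀, N {p | p.1 ≤ 0} = 0 := by
    rw [hP₀, ae_map_iff (measurable_pointMeasure fun n =>
      (hA.measurable n).prodMk (hVm n)).aemeasurable
      (measurableSet_apply_eq_zero measurableSet_fst_nonpos)]
    filter_upwards [hpos] with ω hω
    by_contra h
    obtain ⟨n, hn⟩ := (pointMeasure_apply_ne_zero_iff measurableSet_fst_nonpos).1 h
    exact (hω n).not_ge hn
  have hS : MeasurableSet {N : Measure (ℝ × ℝ) | N {p | p.1 < p.2} = 0} :=
    measurableSet_apply_eq_zero measurableSet_fst_lt_snd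
  have hZ : Measurable (planarProcess x) := measurable_planarProcess x
  have hplanar : ∀ P ∈ ball P₀ δ, 1 - D ≤ P.real {N | N {p | p.1 < p.2} = 0} := by
    intro P hP
    have := hP.1
    have h1 := hupper P hP
    have h2 : P.real {N | N {p | p.1 < p.2} = 0}ᶜ ≤ P.real {N | N {p | p.1 ≤ p.2} ≠ 0} :=
      measureReal_mono fun N hN h => hN (measure_mono_null (fun p (hp : p.1 < p.2) => hp.le) h)
    rw [probReal_compl_eq_one_sub hS] at h2
    linarith
  refine ⟨hatt, ⟨?_, ?_⟩, ⟨?_, ?_⟩, ⟨?_, ?_⟩⟩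
  · rintro _ ⟨P', hP', hball, rfl⟩
    refine (hplanar _ hball).trans ?_
    -- Finite distance carries positivity of the times over to `P'`, so that the maxima `M_k` encode
    -- the planar event almost surely.
    have hae := ae_apply_fst_nonpos_eq_zero (hball.2.trans_lt ENNReal.ofReal_lt_top) hP₀pos
    rw [ae_map_iff hZ.aemeasurable (measurableSet_apply_eq_zero measurableSet_fst_nonpos)] at hae
    rw [map_measureReal_apply hZ hS]
    refine ENNReal.toReal_mono (measure_ne_top _ _) (measure_mono_ae ?_)
    filter_upwards [hae] with z hz hzS
    have hz0 : ∀ n, 0 < (z n).1 := fun n => by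
      by_contra! h
      exact (pointMeasure_apply_ne_zero_iff measurableSet_fst_nonpos).2 ⟨n, h⟩ hz
    refine (forall_compMax_le_iff hd hx hz0).2 fun n => ?_
    by_contra! h
    exact (pointMeasure_apply_ne_zero_iff measurableSet_fst_lt_snd).2 ⟨n, h⟩ hzS
  · intro b hb
    refine le_of_forall_pos_le_add fun ε hε => ?_
    obtain ⟨P', hP', hball, hP'ε⟩ := hlower ε hε
    refine (hb ⟨P', hP', hball, rfl⟩).trans ?_
    have h : P'.real {z | ∀ k, compMax z k ≤ (((x k)⁻¹ : ℝ) : EReal)} ≤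
        P'.real (overtaken x)ᶜ := measureReal_mono fun z hz hz' => by
      obtain ⟨n, hn⟩ := hz'.2
      exact ((forall_compMax_le_iff hd hx hz'.1).1 hz n).not_gt hn
    rw [probReal_compl_eq_one_sub (measurableSet_overtaken x)] at h
    linarith
  · rintro _ ⟨P, hP, rfl⟩
    exact hplanar P hP
  · intro b hb
    refine le_of_forall_pos_le_add fun ε hε => ?_
    obtain ⟨P', hP', hball, hP'ε⟩ := hlower ε hε
    refine (hb ⟨_, hball, rfl⟩).trans ?_
    rw [map_measureReal_apply hZ hS]
    have h : P'.real (planarProcess x ⁻¹' {N | N {p | p.1 < p.2} = 0}) ≤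
        P'.real (overtaken x)ᶜ := measureReal_mono fun z hz hz' => by
      obtain ⟨n, hn⟩ := hz'.2
      exact (pointMeasure_apply_ne_zero_iff measurableSet_fst_lt_snd).2 ⟨n, hn⟩ hz
    rw [probReal_compl_eq_one_sub (measurableSet_overtaken x)] at h
    linarith
  · rintro _ ⟨P, hP, rfl⟩
    have := hP.1
    rw [integral_loss]
    refine le_trans (measureReal_mono (s₂ := {N | N {p | p.1 ≤ p.2} ≠ 0}) fun N hN h => ?_)
      (hupper P hP)
    have h1 : N failureRegion = 0 := measure_mono_null (fun p hp => hp.2) h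
    have h2 : 1 ≤ N failureRegion := hN
    rw [h1] at h2
    exact absurd h2 (by simp)
  · intro b hb
    refine le_of_forall_pos_le_add fun ε hε => ?_
    obtain ⟨P', hP', hball, hP'ε⟩ := hlower ε hε
    have hb' := hb ⟨_, hball, rfl⟩
    rw [integral_loss, map_measureReal_apply hZ
      (measurableSet_le measurable_const (Measure.measurable_coe measurableSet_failureRegion))] at hb'
    have h : P'.real (overtaken x) ≤ P'.real (planarProcess x ⁻¹' {N | 1 ≤ N failureRegion}) :=
      measureReal_mono fun z hz => by
        obtain ⟨n, hn⟩ := hz.2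
        exact one_le_pointMeasure_apply measurableSet_failureRegion (n := n) ⟨(hz.1 n).le, hn.le⟩
    linarith
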